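/- Conventions. Consider finite rooted forests $F$ whose vertices are decorated by letters of the alphabet $\{x,y\}$, up to isomorphism; $\emptyset$ is the empty forest, $FF'$ is the concatenation (disjoint union) of $F$ and $F'$, and $B_+^{\omega}(F)$ is the tree obtained by grafting the trees of $F$ onto a new common root decorated by $\omega$. A leaf is a vertex without direct successor, a branching vertex is one with at least two direct successors. A forest is convergent if all its leaves and branching vertices are decorated by $y$ and all its roots are decorated by $x$; let $\mathcal F^{\rm conv}$ be the real algebra spanned by the convergent forests, with product the bilinear extension of concatenation and unit $\emptyset$. A word in $\{x,y\}$ is convergent if it is empty, or starts with $x$ and ends with $y$. Put $\sigma_x(t)=1/t$ and $\sigma_y(t)=1/(1-t)$. For $0<\epsilon<z<1$ define $I_\epsilon^z(\emptyset)=1$, $I_\epsilon^z(\omega w)=\int_\epsilon^z\sigma_\omega(t)\,I_\epsilon^t(w)\,dt$ for a letter $\omega$ and a word $w$, and, on forests, $\widehat I_\epsilon^z(\emptyset)=1$, $\widehat I_\epsilon^z(FF')=\widehat I_\epsilon^z(F)\,\widehat I_\epsilon^z(F')$, $\widehat I_\epsilon^z(B_+^\omega(F))=\int_\epsilon^z\sigma_\omega(t)\,\widehat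 I_\epsilon^t(F)\,dt$. For $z\in(0,1)$ let $Li_w(z)=\lim_{\epsilon\to0^+}I_\epsilon^z(w)$ and $Li^T_F(z)=\lim_{\epsilon\to0^+}\widehat I_\epsilon^z(F)$; let $\zeta_{\text{shuffle}}(w)=\lim_{z\to1^-}Li_w(z)$ (the shuffle multiple zeta value of $w$) and $\zeta^T_{\text{shuffle}}(F)=\lim_{z\to1^-}Li^T_F(z)$ (the shuffle arborified zeta value of $F$). Theorem. For every convergent word $w$ the limits defining $Li_w(z)$, $z\in(0,1)$, and $\zeta_{\text{shuffle}}(w)$ exist and are finite, and for every convergent forest $F$ the limits defining $Li^T_F(z)$, $z\in(0,1)$, and $\zeta^T_{\text{shuffle}}(F)$ exist and are finite. For every convergent forest $F$, $\zeta^T_{\text{shuffle}}(F)$ is a finite linear combination, with integer (in particular rational) coefficients, of shuffle multiple zeta values $\zeta_{\text{shuffle}}(w)$ of convergent words $w$. Moreover the linear extension $\zeta^T_{\text{shuffle}}:\mathcal F^{\rm conv}\to\mathbb R$ is a morphism of unital $\mathbb R$-algebras for the concatenation of forests. -/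

import Mathlib

open Filter Topology

namespace ArborifiedZeta

noncomputable section

/-! ### Decorated rooted trees and forests -/

/-- Plane rooted trees with vertices decorated by `Ω`: `node a l` has a root decorated by `a`,
whose direct successors are the roots of the trees in the list `l` (in this order). -/
inductive PlaneTree (Ω : Type*) where
  | node : Ω → List (PlaneTree Ω) → PlaneTree Ω

namespace PlaneTree

/-- Two plane trees differ by one elementary move: reordering the branches at one vertex. The
equivalence relation generated by these moves is isomorphism of decorated rooted trees. -/
inductive Step {Ω : Type*} : PlaneTree Ω → PlaneTree Ω → Prop
  | perm (a : Ω) (l l' : List (PlaneTree Ω)) (h : l.Perm l') : Step (node a l) (node a l')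
  | child (a : Ω) (l r : List (PlaneTree Ω)) (t t' : PlaneTree Ω) (h : Step t t') :
      Step (node a (l ++ t :: r)) (node a (l ++ t' :: r))

/-- The decoration of the root. -/
def root {Ω : Type*} : PlaneTree Ω → Ω
  | node a _ => a

mutual
  /-- The value of the operated-monoid morphism determined by `β : Ω → A → A` on a tree. -/
  def eval {Ω A : Type*} [CommMonoid A] (β : Ω → A → A) : PlaneTree Ω → A
    | node a l => β a (evalList β l)
  /-- The product of the values `eval β t` over the trees `t` of a list. -/
  def evalList {Ω A : Type*} [CommMonoid A] (β : Ω → A → A) : List (PlaneTree Ω) → A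
    | [] => 1
    | t :: l => eval β t * evalList β l
end

theorem evalList_eq {Ω A : Type*} [CommMonoid A] (β : Ω → A → A) (l : List (PlaneTree Ω)) :
    evalList β l = (l.map (eval β)).prod := by
  induction l with
  | nil => simp [evalList]
  | cons t l ih => simp [evalList, ih]

theorem eval_step {Ω A : Type*} [CommMonoid A] (β : Ω → A → A) {t t' : PlaneTree Ω}
    (h : Step t t') : eval β t = eval β t' := by
  induction h with
  | perm a l l' h => simp only [eval, evalList_eq, (h.map (eval β)).prod_eq]
  | child a l r t t' _ ih => simp [eval, evalList_eq, ih]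

theorem root_step {Ω : Type*} {t t' : PlaneTree Ω} (h : Step t t') : root t = root t' := by
  cases h <;> rfl

end PlaneTree

/-- (Isomorphism classes of) rooted trees decorated by `Ω`, without order on the branches. -/
def Tree (Ω : Type*) : Type _ := Quot (PlaneTree.Step (Ω := Ω))

/-- The decoration of the root of a tree. -/
def Tree.root {Ω : Type*} : Tree Ω → Ω :=
  Quot.lift PlaneTree.root fun _ _ h => PlaneTree.root_step h

/-- The value on trees of the morphism determined by `β : Ω → A → A`. -/
def Tree.eval {Ω A : Type*} [CommMonoid A] (β : Ω → A → A) : Tree Ω → A :=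
  Quot.lift (PlaneTree.eval β) fun _ _ h => PlaneTree.eval_step β h

/-- Rooted forests decorated by `Ω`: finite multisets of trees. The sum of multisets is the
concatenation of forests and `0` is the empty forest. -/
abbrev Forest (Ω : Type*) : Type _ := Multiset (Tree Ω)

/-- The unique morphism `Φ` from forests to a commutative monoid `A` on which `Ω` operates by `β`:
`Φ ∅ = 1`, `Φ (F F') = Φ F * Φ F'`, and `Φ T = β a (Φ F)` when the tree `T` is obtained by grafting
the trees of `F` on a common root decorated by `a`. -/
def Forest.eval {Ω A : Type*} [CommMonoid A] (β : Ω → A → A) (F : Forest Ω) : A :=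
  (Multiset.map (Tree.eval β) F).prod

/-- The real commutative algebra freely generated by decorated rooted trees: linear combinations of
forests, with the product extending the concatenation of forests. -/
abbrev ForestAlg (Ω : Type*) : Type _ := AddMonoidAlgebra ℝ (Forest Ω)

/-! ### The alphabet `{x, y}` and convergence -/

/-- The two-letter alphabet. -/
inductive Letter where
  | x
  | y

namespace PlaneTree

mutual
  /-- All leaves (vertices without direct successor) and all branching vertices (vertices with at
  least two direct successors) are decorated by `y`. -/
  def IsSemiconvergent : PlaneTree Letter → Prop
    | node a l => (l = [] → a = Letter.y) ∧ (2 ≤ l.length → a = Letter.y) ∧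
        AllSemiconvergent l
  /-- All trees of a list are semiconvergent. -/
  def AllSemiconvergent : List (PlaneTree Letter) → Prop
    | [] => True
    | t :: l => IsSemiconvergent t ∧ AllSemiconvergent l
end

theorem allSemiconvergent_iff (l : List (PlaneTree Letter)) :
    AllSemiconvergent l ↔ ∀ t ∈ l, IsSemiconvergent t := by
  induction l with
  | nil => simp [AllSemiconvergent]
  | cons t l ih => simp [AllSemiconvergent, ih]

theorem isSemiconvergent_step {t t' : PlaneTree Letter} (h : Step t t') :
    IsSemiconvergent t = IsSemiconvergent t' := by
  induction h with
  | perm a l l' h =>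
    have h0 : l = [] ↔ l' = [] := by
      rw [← List.length_eq_zero_iff, ← List.length_eq_zero_iff, h.length_eq]
    simp only [IsSemiconvergent, allSemiconvergent_iff, h0, h.length_eq, h.mem_iff]
  | child a l r t t' _ ih =>
    simp [IsSemiconvergent, allSemiconvergent_iff, or_imp, forall_and, ih]

end PlaneTree

/-- All leaves and all branching vertices of the tree are decorated by `y`. -/
def Tree.IsSemiconvergent : Tree Letter → Prop :=
  Quot.lift PlaneTree.IsSemiconvergent fun _ _ h => PlaneTree.isSemiconvergent_step h

/-- A forest is semiconvergent if its leaves and branching vertices are decorated by `y`. -/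
def Forest.IsSemiconvergent (F : Forest Letter) : Prop := ∀ T ∈ F, T.IsSemiconvergent

/-- A forest is convergent if it is semiconvergent and its roots are decorated by `x`. -/
def Forest.IsConvergent (F : Forest Letter) : Prop :=
  F.IsSemiconvergent ∧ ∀ T ∈ F, T.root = Letter.x

theorem Forest.isConvergent_zero : Forest.IsConvergent 0 :=
  ⟨fun T hT => absurd hT (Multiset.notMem_zero T), fun T hT => absurd hT (Multiset.notMem_zero T)⟩

theorem Forest.IsConvergent.add {F F' : Forest Letter} (h : F.IsConvergent)
    (h' : F'.IsConvergent) : Forest.IsConvergent (F + F') :=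
  ⟨fun T hT => (Multiset.mem_add.1 hT).elim (h.1 T) (h'.1 T),
    fun T hT => (Multiset.mem_add.1 hT).elim (h.2 T) (h'.2 T)⟩

/-- The linear span of the convergent forests, a subalgebra of the algebra of forests. -/
def convAlg : Subalgebra ℝ (ForestAlg Letter) :=
  (Submodule.span ℝ
    ((fun F : Forest Letter => (AddMonoidAlgebra.single F 1 : ForestAlg Letter)) ''
      {F | F.IsConvergent})).toSubalgebra
    (Submodule.subset_span ⟨0, Forest.isConvergent_zero, rfl⟩)
    (by
      intro a b ha hb
      have hab := Submodule.mul_mem_mul ha hb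
      rw [Submodule.span_mul_span] at hab
      refine Submodule.span_mono ?_ hab
      rintro _ ⟨_, ⟨F, hF, rfl⟩, _, ⟨F', hF', rfl⟩, rfl⟩
      exact ⟨F + F', hF.add hF', by simp [AddMonoidAlgebra.single_mul_single]⟩)

/-- A word is convergent if it is empty, or if it starts with `x` and ends with `y`. -/
def IsConvergentWord (w : List Letter) : Prop :=
  w = [] ∨ (w.head? = some Letter.x ∧ w.getLast? = some Letter.y)

/-! ### Iterated integrals, polylogarithms and zeta values -/

/-- The functions `σ_x(t) = 1 / t` and `σ_y(t) = 1 / (1 - t)`. -/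
def sigma : Letter → ℝ → ℝ
  | Letter.x => fun t => 1 / t
  | Letter.y => fun t => 1 / (1 - t)

/-- The operation of a letter `a` on functions: `f ↦ (z ↦ ∫_ε^z σ_a(t) f(t) dt)`. -/
def integralOp (ε : ℝ) (a : Letter) (f : ℝ → ℝ) : ℝ → ℝ :=
  fun z => ∫ t in ε..z, sigma a t * f t

/-- The Chen iterated integral, with lower bound `ε`, of a word. -/
def chen (ε : ℝ) (w : List Letter) : ℝ → ℝ := w.foldr (integralOp ε) 1

/-- The arborified Chen integral, with lower bound `ε`, of a forest: the branching of the
integration map from `ε`, after replacing each decoration `a` by the function `σ_a`. -/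
def chenT (ε : ℝ) (F : Forest Letter) : ℝ → ℝ := F.eval (integralOp ε)

/-- The single variable multiple polylogarithm of a (semiconvergent) word, on `[0,1)`. -/
def Li (w : List Letter) (z : ℝ) : ℝ :=
  if z = 0 then 0 else limUnder (𝓝[>] (0 : ℝ)) fun ε => chen ε w z

/-- The arborified polylogarithm of a (semiconvergent) forest, on `[0,1)`. -/
def LiT (F : Forest Letter) (z : ℝ) : ℝ :=
  if z = 0 then 0 else limUnder (𝓝[>] (0 : ℝ)) fun ε => chenT ε F z

/-- The shuffle multiple zeta value of a (convergent) word. -/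
def zeta (w : List Letter) : ℝ := limUnder (𝓝[<] (1 : ℝ)) (Li w)

/-- The shuffle arborified zeta value of a (convergent) forest. -/
def zetaT (F : Forest Letter) : ℝ := limUnder (𝓝[<] (1 : ℝ)) (LiT F)

/-- The shuffle arborified zeta map on the algebra spanned by the convergent forests: the linear
extension of `F ↦ zetaT F`. -/
def zetaTConv : convAlg →ₗ[ℝ] ℝ :=
  (Finsupp.linearCombination ℝ zetaT ∘ₗ
    (AddMonoidAlgebra.coeffLinearEquiv ℝ).toLinearMap) ∘ₗ convAlg.toSubmodule.subtype

end

end ArborifiedZeta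

open ArborifiedZeta

namespace ArborifiedZeta

open Set

/-! ### Analytic properties of the integration operators -/

-- Integration by parts shows that a product of two iterated integrals from the same `ε` is the sum
-- of the iterated integrals of the shuffles (`chen_mul_chen`). Induction on trees then writes the
-- arborified integral of a convergent forest, for every `ε`, as a sum over a finite multiset of
-- words independent of `ε` and `z` (`Forest.exists_isFlattening`): concatenation becomes shuffling
-- and grafting becomes prefixing a letter. Decorations `y` at the leaves make all words end in `y`;
-- roots `x` make the nonempty ones start with `x`. Convergence therefore only has to be proved for
-- words. Their integrals are nonnegative and monotone in both bounds, so the uniform bound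
-- `exists_chen_le` suffices. Finite sums commute with the limits, and multiplicities give the
-- integer coefficients. Multiplicativity holds for each `ε` by construction and passes to the
-- limit.

theorem continuousOn_sigma (a : Letter) : ContinuousOn (sigma a) (Ioo 0 1) := by
  cases a
  · exact continuousOn_const.div continuousOn_id fun t ht => ht.1.ne'
  · exact continuousOn_const.div (continuousOn_const.sub continuousOn_id)
      fun t ht => (sub_pos.2 ht.2).ne'

theorem sigma_nonneg (a : Letter) {t : ℝ} (ht : t ∈ Ioo (0 : ℝ) 1) : 0 ≤ sigma a t := by
  cases a
  · exact (one_div_pos.2 ht.1).le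
  · exact (one_div_pos.2 (sub_pos.2 ht.2)).le

theorem uIcc_subset_Ioo {ε z : ℝ} (hε : ε ∈ Ioo (0 : ℝ) 1) (hz : z ∈ Ioo (0 : ℝ) 1) :
    uIcc ε z ⊆ Ioo (0 : ℝ) 1 :=
  (ordConnected_Ioo : (Ioo (0 : ℝ) 1).OrdConnected).uIcc_subset hε hz

theorem intervalIntegrable_of_continuousOn_Ioo {f : ℝ → ℝ} (hf : ContinuousOn f (Ioo 0 1))
    {ε z : ℝ} (hε : ε ∈ Ioo (0 : ℝ) 1) (hz : z ∈ Ioo (0 : ℝ) 1) :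
    IntervalIntegrable f MeasureTheory.volume ε z :=
  (hf.mono (uIcc_subset_Ioo hε hz)).intervalIntegrable

theorem hasDerivAt_integralOp {ε z : ℝ} (hε : ε ∈ Ioo (0 : ℝ) 1) (hz : z ∈ Ioo (0 : ℝ) 1)
    (a : Letter) {f : ℝ → ℝ} (hf : ContinuousOn f (Ioo 0 1)) :
    HasDerivAt (integralOp ε a f) (sigma a z * f z) z := by
  have hc : ContinuousOn (fun t => sigma a t * f t) (Ioo 0 1) := (continuousOn_sigma a).mul hf
  exact intervalIntegral.integral_hasDerivAt_right
    (intervalIntegrable_of_continuousOn_Ioo hc hε hz)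
    (hc.stronglyMeasurableAtFilter isOpen_Ioo z hz) (hc.continuousAt (isOpen_Ioo.mem_nhds hz))

theorem continuousOn_integralOp {ε : ℝ} (hε : ε ∈ Ioo (0 : ℝ) 1) (a : Letter) {f : ℝ → ℝ}
    (hf : ContinuousOn f (Ioo 0 1)) : ContinuousOn (integralOp ε a f) (Ioo 0 1) :=
  fun _ hz => (hasDerivAt_integralOp hε hz a hf).continuousAt.continuousWithinAt

theorem integralOp_self (ε : ℝ) (a : Letter) (f : ℝ → ℝ) : integralOp ε a f ε = 0 :=
  intervalIntegral.integral_same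

theorem integralOp_congr {ε z : ℝ} (hε : ε ∈ Ioo (0 : ℝ) 1) (hz : z ∈ Ioo (0 : ℝ) 1)
    (a : Letter) {f g : ℝ → ℝ} (h : EqOn f g (Ioo 0 1)) :
    integralOp ε a f z = integralOp ε a g z :=
  intervalIntegral.integral_congr fun t ht => by
    simp only [h (uIcc_subset_Ioo hε hz ht)]

/-- Integration by parts: the integration operators satisfy the shuffle relation. -/
theorem integralOp_mul_integralOp {ε z : ℝ} (hε : ε ∈ Ioo (0 : ℝ) 1) (hz : z ∈ Ioo (0 : ℝ) 1)
    (a b : Letter) {f g : ℝ → ℝ} (hf : ContinuousOn f (Ioo 0 1))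
    (hg : ContinuousOn g (Ioo 0 1)) :
    integralOp ε a f z * integralOp ε b g z =
      integralOp ε a (f * integralOp ε b g) z + integralOp ε b (integralOp ε a f * g) z := by
  have hF := continuousOn_integralOp hε a hf
  have hG := continuousOn_integralOp hε b hg
  have h1 : ContinuousOn (fun t => sigma a t * f t * integralOp ε b g t) (Ioo 0 1) :=
    ((continuousOn_sigma a).mul hf).mul hG
  have h2 : ContinuousOn (fun t => integralOp ε a f t * (sigma b t * g t)) (Ioo 0 1) :=
    hF.mul ((continuousOn_sigma b).mul hg)
  have key := intervalIntegral.integral_eq_sub_of_hasDerivAt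
    (fun t ht => (hasDerivAt_integralOp hε (uIcc_subset_Ioo hε hz ht) a hf).mul
      (hasDerivAt_integralOp hε (uIcc_subset_Ioo hε hz ht) b hg))
    (intervalIntegrable_of_continuousOn_Ioo (h1.add h2) hε hz)
  rw [intervalIntegral.integral_add (intervalIntegrable_of_continuousOn_Ioo h1 hε hz)
    (intervalIntegrable_of_continuousOn_Ioo h2 hε hz)] at key
  -- The boundary term at `ε` vanishes, as both factors are integrals starting there.
  simp only [Pi.mul_apply, integralOp_self, mul_zero, sub_zero] at key
  rw [← key]
  simp only [integralOp, Pi.mul_apply]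
  congr 1 <;> exact intervalIntegral.integral_congr fun t _ => by ring

theorem integralOp_multiset_sum {ι : Type*} {ε z : ℝ} (hε : ε ∈ Ioo (0 : ℝ) 1)
    (hz : z ∈ Ioo (0 : ℝ) 1) (a : Letter) {f : ι → ℝ → ℝ}
    (hf : ∀ i, ContinuousOn (f i) (Ioo 0 1)) (s : Multiset ι) :
    integralOp ε a (fun t => (s.map fun i => f i t).sum) z =
      (s.map fun i => integralOp ε a (f i) z).sum := by
  induction s using Multiset.induction_on with
  | empty => simp [integralOp]
  | cons i s ih =>
    simp only [Multiset.map_cons, Multiset.sum_cons, ← ih]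
    simp only [integralOp, mul_add]
    refine intervalIntegral.integral_add
      (intervalIntegrable_of_continuousOn_Ioo ((continuousOn_sigma a).mul (hf i)) hε hz)
      (intervalIntegrable_of_continuousOn_Ioo ((continuousOn_sigma a).mul ?_) hε hz)
    exact continuousOn_multiset_sum s fun i _ => hf i

/-! ### Iterated integrals of words -/

theorem chen_nil (ε : ℝ) : chen ε [] = 1 := rfl

theorem chen_cons (ε : ℝ) (a : Letter) (w : List Letter) :
    chen ε (a :: w) = integralOp ε a (chen ε w) := rfl

theorem continuousOn_chen {ε : ℝ} (hε : ε ∈ Ioo (0 : ℝ) 1) (w : List Letter) :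
    ContinuousOn (chen ε w) (Ioo 0 1) := by
  induction w with
  | nil => exact continuousOn_const
  | cons a w ih => exact continuousOn_integralOp hε a ih

theorem intervalIntegrable_sigma_mul_chen {ε a b : ℝ} (hε : ε ∈ Ioo (0 : ℝ) 1)
    (ha : a ∈ Ioo (0 : ℝ) 1) (hb : b ∈ Ioo (0 : ℝ) 1) (l : Letter) (w : List Letter) :
    IntervalIntegrable (fun t => sigma l t * chen ε w t) MeasureTheory.volume a b :=
  intervalIntegrable_of_continuousOn_Ioo ((continuousOn_sigma l).mul (continuousOn_chen hε w)) ha hb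

theorem chen_nonneg {ε : ℝ} (hε : 0 < ε) (w : List Letter) {z : ℝ} (hz : z ∈ Ico ε 1) :
    0 ≤ chen ε w z := by
  induction w generalizing z with
  | nil => exact zero_le_one
  | cons a w ih =>
    exact intervalIntegral.integral_nonneg hz.1 fun t ht =>
      mul_nonneg (sigma_nonneg a ⟨hε.trans_le ht.1, ht.2.trans_lt hz.2⟩)
        (ih ⟨ht.1, ht.2.trans_lt hz.2⟩)

theorem chen_mono {ε : ℝ} (hε : 0 < ε) (w : List Letter) {z z' : ℝ} (hz : ε ≤ z) (hzz' : z ≤ z')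
    (hz' : z' < 1) : chen ε w z ≤ chen ε w z' := by
  cases w with
  | nil => exact le_rfl
  | cons a w =>
    have hε' : ε ∈ Ioo (0 : ℝ) 1 := ⟨hε, hz.trans_lt (hzz'.trans_lt hz')⟩
    have hzm : z ∈ Ioo (0 : ℝ) 1 := ⟨hε.trans_le hz, hzz'.trans_lt hz'⟩
    have hzm' : z' ∈ Ioo (0 : ℝ) 1 := ⟨hzm.1.trans_le hzz', hz'⟩
    have h := intervalIntegral.integral_add_adjacent_intervals
      (intervalIntegrable_sigma_mul_chen hε' hε' hzm a w)
      (intervalIntegrable_sigma_mul_chen hε' hzm hzm' a w)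
    have h0 : 0 ≤ ∫ t in z..z', sigma a t * chen ε w t :=
      intervalIntegral.integral_nonneg hzz' fun t ht =>
        mul_nonneg (sigma_nonneg a ⟨hzm.1.trans_le ht.1, ht.2.trans_lt hz'⟩)
          (chen_nonneg hε w ⟨hz.trans ht.1, ht.2.trans_lt hz'⟩)
    simp only [chen_cons, integralOp]
    linarith

/-- Raising the lower bound removes a nonnegative piece of the outer integral and, by induction,
decreases the remaining integrand. -/
theorem chen_antitone_left {ε ε' : ℝ} (hε : 0 < ε) (hεε' : ε ≤ ε') (w : List Letter) {z : ℝ}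
    (hz : z ∈ Ico ε' 1) : chen ε' w z ≤ chen ε w z := by
  induction w generalizing z with
  | nil => rw [chen_nil, chen_nil]
  | cons a w ih =>
    have hzm : z ∈ Ioo (0 : ℝ) 1 := ⟨hε.trans_le (hεε'.trans hz.1), hz.2⟩
    have hεm : ε ∈ Ioo (0 : ℝ) 1 := ⟨hε, hεε'.trans_lt (hz.1.trans_lt hz.2)⟩
    have hεm' : ε' ∈ Ioo (0 : ℝ) 1 := ⟨hε.trans_le hεε', hz.1.trans_lt hz.2⟩
    have h := intervalIntegral.integral_add_adjacent_intervals
      (intervalIntegrable_sigma_mul_chen hεm hεm hεm' a w)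
      (intervalIntegrable_sigma_mul_chen hεm hεm' hzm a w)
    have h0 : 0 ≤ ∫ t in ε..ε', sigma a t * chen ε w t :=
      intervalIntegral.integral_nonneg hεε' fun t ht =>
        mul_nonneg (sigma_nonneg a ⟨hε.trans_le ht.1, ht.2.trans_lt hεm'.2⟩)
          (chen_nonneg hε w ⟨ht.1, ht.2.trans_lt hεm'.2⟩)
    have h1 : ∫ t in ε'..z, sigma a t * chen ε' w t ≤ ∫ t in ε'..z, sigma a t * chen ε w t :=
      intervalIntegral.integral_mono_on hz.1
        (intervalIntegrable_sigma_mul_chen hεm' hεm' hzm a w)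
        (intervalIntegrable_sigma_mul_chen hεm hεm' hzm a w) fun t ht =>
          mul_le_mul_of_nonneg_left (ih ⟨ht.1, ht.2.trans_lt hz.2⟩)
            (sigma_nonneg a ⟨hεm'.1.trans_le ht.1, ht.2.trans_lt hz.2⟩)
    simp only [chen_cons, integralOp]
    linarith

/-- Comparison of an iterated integral with a function whose derivative dominates the integrand. -/
theorem chen_cons_le_sub {ε z : ℝ} (hε : 0 < ε) (hz : z ∈ Ico ε 1) (a : Letter)
    (w : List Letter) {k k' : ℝ → ℝ} (hk : ∀ t ∈ Ioo (0 : ℝ) 1, HasDerivAt k (k' t) t)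
    (hle : ∀ t ∈ Ico ε 1, sigma a t * chen ε w t ≤ k' t) :
    chen ε (a :: w) z ≤ k z - k ε := by
  have hzm : z ∈ Ioo (0 : ℝ) 1 := ⟨hε.trans_le hz.1, hz.2⟩
  have hεm : ε ∈ Ioo (0 : ℝ) 1 := ⟨hε, hz.1.trans_lt hz.2⟩
  have hsub : Icc ε z ⊆ Ioo (0 : ℝ) 1 := fun t ht => ⟨hε.trans_le ht.1, ht.2.trans_lt hz.2⟩
  -- This form of the comparison needs integrability of the integrand only, not of `k'`.
  refine intervalIntegral.integral_le_sub_of_hasDeriv_right_of_le hz.1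
    (fun t ht => (hk t (hsub ht)).continuousAt.continuousWithinAt)
    (fun t ht => (hk t (hsub (Ioo_subset_Icc_self ht))).hasDerivWithinAt) ?_
    (fun t ht => hle t ⟨ht.1.le, ht.2.trans hz.2⟩)
  exact (((continuousOn_sigma a).mul (continuousOn_chen hεm w)).mono hsub).integrableOn_Icc

/-- The majorant `g = √t / √(1 - t)` is chosen because `g' / g = 1 / (2t(1 - t))` is half of `1/t +
1/(1 - t)`, which dominates both forms `sigma a`. -/
theorem hasDerivAt_sqrt_div_sqrt {t : ℝ} (ht : t ∈ Ioo (0 : ℝ) 1) :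
    HasDerivAt (fun t : ℝ => √t / √(1 - t)) (√t / √(1 - t) / (2 * t * (1 - t))) t := by
  have h0 : 0 < t := ht.1
  have h1 : 0 < 1 - t := sub_pos.2 ht.2
  have hs : 0 < √t := Real.sqrt_pos.2 h0
  have hr : 0 < √(1 - t) := Real.sqrt_pos.2 h1
  have hs2 : √t ^ 2 = t := Real.sq_sqrt h0.le
  have hr2 : √(1 - t) ^ 2 = 1 - t := Real.sq_sqrt h1.le
  refine (((hasDerivAt_id' t).sqrt h0.ne').div
    (((hasDerivAt_id' t).const_sub 1).sqrt h1.ne') hr.ne').congr_deriv ?_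
  generalize √t = s at *
  generalize √(1 - t) = r at *
  rw [← hr2, ← hs2]
  field_simp
  -- What remains is a multiple of `s² + r² = 1`.
  linear_combination hs2 + hr2

theorem hasDerivAt_sqrt_sub_sqrt {t : ℝ} (ht : t ∈ Ioo (0 : ℝ) 1) :
    HasDerivAt (fun t : ℝ => 2 * √t - 2 * √(1 - t)) (1 / √t + 1 / √(1 - t)) t := by
  have h0 : 0 < t := ht.1
  have h1 : 0 < 1 - t := sub_pos.2 ht.2
  have hs : 0 < √t := Real.sqrt_pos.2 h0
  have hr : 0 < √(1 - t) := Real.sqrt_pos.2 h1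
  refine ((((hasDerivAt_id' t).sqrt h0.ne').const_mul 2).sub
    ((((hasDerivAt_id' t).const_sub 1).sqrt h1.ne').const_mul 2)).congr_deriv ?_
  field_simp
  ring

/-- A word is semiconvergent if it is empty or ends with `y`. -/
def IsSemiconvergentWord (w : List Letter) : Prop := w = [] ∨ w.getLast? = some Letter.y

theorem isSemiconvergentWord_cons {a : Letter} {w : List Letter} (ha : w = [] → a = Letter.y)
    (hw : IsSemiconvergentWord w) : IsSemiconvergentWord (a :: w) := by
  rcases w with _ | ⟨b, w⟩
  · simp [IsSemiconvergentWord, ha rfl]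
  · simpa [IsSemiconvergentWord, List.getLast?_cons_cons] using hw

theorem IsSemiconvergentWord.of_cons {a : Letter} {w : List Letter}
    (h : IsSemiconvergentWord (a :: w)) : (w = [] → a = Letter.y) ∧ IsSemiconvergentWord w := by
  rcases w with _ | ⟨b, w⟩
  · simpa [IsSemiconvergentWord] using h
  · simpa [IsSemiconvergentWord, List.getLast?_cons_cons] using h

theorem IsConvergentWord.isSemiconvergentWord {w : List Letter} (h : IsConvergentWord w) :
    IsSemiconvergentWord w :=
  h.imp id And.right

theorem sigma_le (a : Letter) {t : ℝ} (ht : t ∈ Ioo (0 : ℝ) 1) :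
    sigma a t ≤ 2 * (1 / (2 * t * (1 - t))) := by
  have h0 : 0 < t := ht.1
  have h1 : 0 < 1 - t := sub_pos.2 ht.2
  have h : 2 * (1 / (2 * t * (1 - t))) = 1 / t + 1 / (1 - t) := by field_simp; ring
  rw [h]
  cases a
  · simpa [sigma] using h1.le
  · simpa [sigma] using h0.le

/-- By `sigma_le`, multiplying `g = √t / √(1 - t)` by any `sigma a` gives at most `2g'`, so each
further letter costs a factor 2. The induction starts at the last letter, which must be `y`: `1/t`
is not integrable at 0. -/
theorem chen_le_sqrt_div_sqrt {w : List Letter} (hw : IsSemiconvergentWord w) (hne : w ≠ [])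
    {ε : ℝ} (hε : 0 < ε) {z : ℝ} (hz : z ∈ Ico ε 1) :
    chen ε w z ≤ 2 ^ w.length * (√z / √(1 - z)) := by
  induction w generalizing z with
  | nil => exact absurd rfl hne
  | cons a w ih =>
    obtain ⟨ha, hw'⟩ := hw.of_cons
    have hk : ∀ t ∈ Ioo (0 : ℝ) 1, HasDerivAt
        (fun t : ℝ => 2 ^ (a :: w).length * (√t / √(1 - t)))
        (2 ^ (a :: w).length * (√t / √(1 - t) / (2 * t * (1 - t)))) t :=
      fun t ht => (hasDerivAt_sqrt_div_sqrt ht).const_mul _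
    refine (chen_cons_le_sub hε hz a w hk fun t ht => ?_).trans (sub_le_self _ (by positivity))
    have htm : t ∈ Ioo (0 : ℝ) 1 := ⟨hε.trans_le ht.1, ht.2⟩
    have h0 : 0 < t := htm.1
    have h1 : 0 < 1 - t := sub_pos.2 htm.2
    by_cases hnil : w = []
    · subst hnil
      rw [ha rfl]
      have hs : 0 < √t := Real.sqrt_pos.2 h0
      have hr : 0 < √(1 - t) := Real.sqrt_pos.2 h1
      have hs1 : √t ≤ 1 := Real.sqrt_le_one.2 htm.2.le
      have hr1 : √(1 - t) ≤ 1 := Real.sqrt_le_one.2 (by linarith)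
      have hs2 : √t ^ 2 = t := Real.sq_sqrt h0.le
      -- For the word `y`, the majorant's derivative is `1/(1 - t)` times a factor that is at least
      -- 1.
      have e : (2 : ℝ) ^ [Letter.y].length * (√t / √(1 - t) / (2 * t * (1 - t)))
          = 1 / (1 - t) * (1 / (√t * √(1 - t))) := by
        simp only [List.length_singleton, pow_one]
        generalize √t = s at *
        rw [show 2 * t * (1 - t) = 2 * s ^ 2 * (1 - t) by rw [hs2]]
        field_simp
      rw [e]
      refine mul_le_mul_of_nonneg_left ?_ (one_div_pos.2 h1).le
      rw [chen_nil, Pi.one_apply, le_div_iff₀ (by positivity), one_mul]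
      exact mul_le_one₀ hs1 hr.le hr1
    · calc sigma a t * chen ε w t
          ≤ 2 * (1 / (2 * t * (1 - t))) * (2 ^ w.length * (√t / √(1 - t))) :=
            mul_le_mul (sigma_le a htm) (ih hw' hnil ht) (chen_nonneg hε w ht)
              (by positivity)
        _ = 2 ^ (a :: w).length * (√t / √(1 - t) / (2 * t * (1 - t))) := by
            rw [List.length_cons, pow_succ]; ring

/-- The iterated integrals of a convergent word are bounded uniformly in both bounds. -/
theorem exists_chen_le {w : List Letter} (hw : IsConvergentWord w) :
    ∃ C : ℝ, ∀ ε z, 0 < ε → z ∈ Ico ε 1 → chen ε w z ≤ C := by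
  rcases w with _ | ⟨a, w⟩
  · exact ⟨1, fun _ _ _ _ => le_rfl⟩
  have hsc := hw.isSemiconvergentWord.of_cons
  have hax : a = Letter.x := by
    rcases hw with h | h
    · cases h
    · simpa using h.1
  subst hax
  have hne : w ≠ [] := fun h => by cases hsc.1 h
  -- The outer `1/t` turns the majorant of the tail into `1/(√t √(1 - t))`, integrable at both ends.
  -- The primitive `2√t - 2√(1 - t)` increases by at most 4.
  refine ⟨2 ^ w.length * 4, fun ε z hε hz => ?_⟩
  have hk : ∀ t ∈ Ioo (0 : ℝ) 1, HasDerivAt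
      (fun t : ℝ => 2 ^ w.length * (2 * √t - 2 * √(1 - t)))
      (2 ^ w.length * (1 / √t + 1 / √(1 - t))) t :=
    fun t ht => (hasDerivAt_sqrt_sub_sqrt ht).const_mul _
  refine (chen_cons_le_sub hε hz Letter.x w hk fun t ht => ?_).trans ?_
  · have h0 : 0 < t := hε.trans_le ht.1
    have h1 : 0 < 1 - t := sub_pos.2 ht.2
    have hs : 0 < √t := Real.sqrt_pos.2 h0
    have hr : 0 < √(1 - t) := Real.sqrt_pos.2 h1
    have hs2 : √t ^ 2 = t := Real.sq_sqrt h0.le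
    have hr2 : √(1 - t) ^ 2 = 1 - t := Real.sq_sqrt h1.le
    -- The square of the right side is `1 + 2√t√(1 - t)`.
    have hsr : 1 ≤ √t + √(1 - t) := by nlinarith [mul_pos hs hr]
    calc sigma Letter.x t * chen ε w t
        ≤ 1 / t * (2 ^ w.length * (√t / √(1 - t))) :=
          mul_le_mul_of_nonneg_left
            (chen_le_sqrt_div_sqrt hsc.2 hne hε ht) (one_div_pos.2 h0).le
      _ = 2 ^ w.length * (1 / (√t * √(1 - t))) := by
          generalize √t = s at *
          rw [← hs2]
          field_simp
      _ ≤ 2 ^ w.length * (1 / √t + 1 / √(1 - t)) := by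
          refine mul_le_mul_of_nonneg_left ?_ (by positivity)
          rw [div_add_div _ _ hs.ne' hr.ne']
          gcongr
          linarith
  · have h1 : √z ≤ 1 := Real.sqrt_le_one.2 hz.2.le
    have h2 : √(1 - ε) ≤ 1 := Real.sqrt_le_one.2 (by linarith)
    have h3 := Real.sqrt_nonneg ε
    have h4 := Real.sqrt_nonneg (1 - z)
    rw [← mul_sub]
    exact mul_le_mul_of_nonneg_left (by linarith) (by positivity)

/-! ### Polylogarithms and zeta values of convergent words -/

theorem Li_eq_limUnder (w : List Letter) {z : ℝ} (hz : z ∈ Ioo (0 : ℝ) 1) :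
    Li w z = limUnder (𝓝[>] (0 : ℝ)) fun ε => chen ε w z :=
  if_neg hz.1.ne'

theorem LiT_eq_limUnder (F : Forest Letter) {z : ℝ} (hz : z ∈ Ioo (0 : ℝ) 1) :
    LiT F z = limUnder (𝓝[>] (0 : ℝ)) fun ε => chenT ε F z :=
  if_neg hz.1.ne'

theorem tendsto_chen {w : List Letter} (hw : IsConvergentWord w) {z : ℝ}
    (hz : z ∈ Ioo (0 : ℝ) 1) : Tendsto (fun ε => chen ε w z) (𝓝[>] 0) (𝓝 (Li w z)) := by
  obtain ⟨C, hC⟩ := exists_chen_le hw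
  rw [Li_eq_limUnder w hz]
  apply tendsto_nhds_limUnder
  -- The sign turns growth as `ε` decreases to 0 into a monotone function bounded below.
  have hm : MonotoneOn (fun ε => -chen ε w z) (Ioo 0 z) := fun ε hε ε' hε' h =>
    neg_le_neg (chen_antitone_left hε.1 h w ⟨hε'.2.le, hz.2⟩)
  have hb : BddBelow ((fun ε => -chen ε w z) '' Ioo 0 z) := by
    refine ⟨-C, ?_⟩
    rintro _ ⟨ε, hε, rfl⟩
    exact neg_le_neg (hC ε z hε.1 ⟨hε.2.le, hz.2⟩)
  exact ⟨_, by simpa using (hm.tendsto_nhdsWithin_Ioo_right (nonempty_Ioo.2 hz.1) hb).neg⟩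

theorem tendsto_Li {w : List Letter} (hw : IsConvergentWord w) :
    Tendsto (Li w) (𝓝[<] 1) (𝓝 (zeta w)) := by
  obtain ⟨C, hC⟩ := exists_chen_le hw
  apply tendsto_nhds_limUnder
  have hm : MonotoneOn (Li w) (Ioo 0 1) := fun z hz z' hz' h => by
    refine le_of_tendsto_of_tendsto (tendsto_chen hw hz) (tendsto_chen hw hz') ?_
    filter_upwards [Ioo_mem_nhdsGT hz.1] with ε hε
    exact chen_mono hε.1 w hε.2.le h hz'.2
  have hb : BddAbove (Li w '' Ioo 0 1) := by
    refine ⟨C, ?_⟩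
    rintro _ ⟨z, hz, rfl⟩
    refine le_of_tendsto (tendsto_chen hw hz) ?_
    filter_upwards [Ioo_mem_nhdsGT hz.1] with ε hε
    exact hC ε z hε.1 ⟨hε.2.le, hz.2⟩
  exact ⟨_, hm.tendsto_nhdsWithin_Ioo_left (nonempty_Ioo.2 one_pos) hb⟩

/-! ### Shuffles -/

/-- The multiset of the shuffles of two words. -/
def shuffle {α : Type*} : List α → List α → Multiset (List α)
  | [], v => {v}
  | a :: u, [] => {a :: u}
  | a :: u, b :: v =>
    (shuffle u (b :: v)).map (List.cons a) + (shuffle (a :: u) v).map (List.cons b)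

theorem chen_mul_chen {ε : ℝ} (hε : ε ∈ Ioo (0 : ℝ) 1) (u v : List Letter) {z : ℝ}
    (hz : z ∈ Ioo (0 : ℝ) 1) :
    chen ε u z * chen ε v z = ((shuffle u v).map fun w => chen ε w z).sum := by
  induction u, v using shuffle.induct generalizing z with
  | case1 v => simp [shuffle, chen_nil]
  | case2 a u => simp [shuffle, chen_nil]
  | case3 a u b v ih1 ih2 =>
    rw [shuffle, Multiset.map_add, Multiset.sum_add, Multiset.map_map, Multiset.map_map,
      chen_cons, chen_cons, integralOp_mul_integralOp hε hz a b (continuousOn_chen hε u)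
        (continuousOn_chen hε v)]
    simp only [Function.comp_def, chen_cons]
    rw [← integralOp_multiset_sum hε hz a (continuousOn_chen hε),
      ← integralOp_multiset_sum hε hz b (continuousOn_chen hε)]
    exact congrArg₂ (· + ·) (integralOp_congr hε hz a fun t ht => ih1 ht)
      (integralOp_congr hε hz b fun t ht => ih2 ht)

theorem ne_nil_of_mem_shuffle {α : Type*} {u v w : List α} (h : w ∈ shuffle u v)
    (huv : u ≠ [] ∨ v ≠ []) : w ≠ [] := by
  rcases u with _ | ⟨a, u⟩ <;> rcases v with _ | ⟨b, v⟩ <;> simp [shuffle] at h huv ⊢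
  · simp [h]
  · simp [h]
  · rcases h with ⟨_, _, rfl⟩ | ⟨_, _, rfl⟩ <;> simp

/-- The last letter of a shuffle is the last letter of one of the two words. -/
theorem isSemiconvergentWord_of_mem_shuffle {u v w : List Letter} (hu : IsSemiconvergentWord u)
    (hv : IsSemiconvergentWord v) (h : w ∈ shuffle u v) : IsSemiconvergentWord w := by
  induction u, v using shuffle.induct generalizing w with
  | case1 v => rw [shuffle, Multiset.mem_singleton] at h; exact h ▸ hv
  | case2 a u => rw [shuffle, Multiset.mem_singleton] at h; exact h ▸ hu
  | case3 a u b v ih1 ih2 =>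
    rw [shuffle, Multiset.mem_add, Multiset.mem_map, Multiset.mem_map] at h
    rcases h with ⟨w', hw', rfl⟩ | ⟨w', hw', rfl⟩
    · exact isSemiconvergentWord_cons
        (fun h => absurd h (ne_nil_of_mem_shuffle hw' (.inr (List.cons_ne_nil _ _))))
        (ih1 hu.of_cons.2 hv hw')
    · exact isSemiconvergentWord_cons
        (fun h => absurd h (ne_nil_of_mem_shuffle hw' (.inl (List.cons_ne_nil _ _))))
        (ih2 hu hv.of_cons.2 hw')

theorem head?_of_mem_shuffle {α : Type*} {c : α} {u v w : List α}
    (hu : u = [] ∨ u.head? = some c) (hv : v = [] ∨ v.head? = some c) (h : w ∈ shuffle u v) :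
    w = [] ∨ w.head? = some c := by
  rcases u with _ | ⟨a, u⟩ <;> rcases v with _ | ⟨b, v⟩ <;> simp [shuffle] at h hu hv ⊢
  · exact .inl h
  · exact .inr (by simp [h, hv])
  · exact .inr (by simp [h, hu])
  · rcases h with ⟨_, _, rfl⟩ | ⟨_, _, rfl⟩ <;> simp [hu, hv]

/-! ### Flattening of forests -/

/-- On `(0, 1)`, the function `f ε` is the sum of the iterated integrals of the words of `c`, and
these words are semiconvergent. -/
structure IsFlattening (f : ℝ → ℝ → ℝ) (c : Multiset (List Letter)) : Prop where
  semiconvergent : ∀ w ∈ c, IsSemiconvergentWord w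
  eq_sum : ∀ ε ∈ Ioo (0 : ℝ) 1, ∀ z ∈ Ioo (0 : ℝ) 1,
    f ε z = (c.map fun w => chen ε w z).sum

theorem isFlattening_one : IsFlattening 1 {[]} where
  semiconvergent w hw := .inl (Multiset.mem_singleton.1 hw)
  eq_sum ε _ z _ := by simp [chen_nil]

/-- Expand both sums and apply the shuffle relation to each pair of words. -/
theorem IsFlattening.mul {f g : ℝ → ℝ → ℝ} {c d : Multiset (List Letter)}
    (hf : IsFlattening f c) (hg : IsFlattening g d) :
    IsFlattening (f * g) (c.bind fun u => d.bind fun v => shuffle u v) where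
  semiconvergent w hw := by
    simp only [Multiset.mem_bind] at hw
    obtain ⟨u, hu, v, hv, hw⟩ := hw
    exact isSemiconvergentWord_of_mem_shuffle (hf.semiconvergent u hu) (hg.semiconvergent v hv) hw
  eq_sum ε hε z hz := by
    simp only [Pi.mul_apply, hf.eq_sum ε hε z hz, hg.eq_sum ε hε z hz, Multiset.map_bind,
      Multiset.sum_bind, ← chen_mul_chen hε _ _ hz, Multiset.sum_map_mul_left,
      Multiset.sum_map_mul_right]

/-- Linearity of the integral; `ha` excludes the divergent word `x`. -/
theorem IsFlattening.integralOp {f : ℝ → ℝ → ℝ} {c : Multiset (List Letter)}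
    (hf : IsFlattening f c) {a : Letter} (ha : ∀ w ∈ c, w = [] → a = Letter.y) :
    IsFlattening (fun ε => integralOp ε a (f ε)) (c.map (List.cons a)) where
  semiconvergent w hw := by
    obtain ⟨u, hu, rfl⟩ := Multiset.mem_map.1 hw
    exact isSemiconvergentWord_cons (ha u hu) (hf.semiconvergent u hu)
  eq_sum ε hε z hz := by
    rw [Multiset.map_map]
    simp only [Function.comp_def, chen_cons]
    rw [← integralOp_multiset_sum hε hz a (continuousOn_chen hε)]
    exact integralOp_congr hε hz a fun t ht => hf.eq_sum ε hε t ht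

mutual
  -- Tracking the first letter shows that a nonempty list of trees yields only nonempty words, so
  -- the leaf condition alone decides which letter may be prefixed to the empty word.
  theorem PlaneTree.exists_isFlattening : ∀ t : PlaneTree Letter, t.IsSemiconvergent →
      ∃ c, IsFlattening (fun ε => t.eval (integralOp ε)) c ∧
        ∀ w ∈ c, w.head? = some t.root
    | .node a l, h => by
      obtain ⟨hleaf, -, hl⟩ := h
      obtain ⟨c, hc, hne⟩ := PlaneTree.exists_isFlattening_list l hl
      exact ⟨_, hc.integralOp fun w hw hnil => hleaf (by_contra fun h0 => hne h0 w hw hnil),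
        fun w hw => by obtain ⟨_, _, rfl⟩ := Multiset.mem_map.1 hw; rfl⟩
  theorem PlaneTree.exists_isFlattening_list : ∀ l : List (PlaneTree Letter),
      PlaneTree.AllSemiconvergent l →
      ∃ c, IsFlattening (fun ε => PlaneTree.evalList (integralOp ε) l) c ∧
        (l ≠ [] → ∀ w ∈ c, w ≠ [])
    | [], _ => ⟨_, isFlattening_one, fun h => absurd rfl h⟩
    | t :: l, h => by
      obtain ⟨c, hc, hc'⟩ := PlaneTree.exists_isFlattening t h.1
      obtain ⟨d, hd, -⟩ := PlaneTree.exists_isFlattening_list l h.2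
      refine ⟨_, hc.mul hd, fun _ w hw => ?_⟩
      simp only [Multiset.mem_bind] at hw
      obtain ⟨u, hu, v, hv, hw⟩ := hw
      refine ne_nil_of_mem_shuffle hw (.inl ?_)
      rintro rfl
      cases hc' _ hu
end

theorem Tree.exists_isFlattening (T : Tree Letter) (hT : T.IsSemiconvergent) :
    ∃ c, IsFlattening (fun ε => T.eval (integralOp ε)) c ∧ ∀ w ∈ c, w.head? = some T.root := by
  induction T using Quot.inductionOn with
  | _ t => exact PlaneTree.exists_isFlattening t hT

theorem chenT_zero (ε : ℝ) : chenT ε 0 = 1 := rfl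

theorem chenT_add (ε : ℝ) (F F' : Forest Letter) : chenT ε (F + F') = chenT ε F * chenT ε F' := by
  simp [chenT, Forest.eval]

theorem chenT_cons (ε : ℝ) (T : Tree Letter) (F : Forest Letter) :
    chenT ε (T ::ₘ F) = T.eval (integralOp ε) * chenT ε F := by
  simp [chenT, Forest.eval]

/-- The arborified integrals of a convergent forest are sums of iterated integrals of convergent
words. -/
theorem Forest.exists_isFlattening {F : Forest Letter} (hF : F.IsConvergent) :
    ∃ c, IsFlattening (fun ε => chenT ε F) c ∧ ∀ w ∈ c, IsConvergentWord w := by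
  -- Semiconvergence of the words already controls the last letter; only the first is left.
  suffices ∃ c, IsFlattening (fun ε => chenT ε F) c ∧
      ∀ w ∈ c, w = [] ∨ w.head? = some Letter.x by
    obtain ⟨c, hc, hx⟩ := this
    refine ⟨c, hc, fun w hw => ?_⟩
    rcases hx w hw with h | h
    · exact .inl h
    · exact (hc.semiconvergent w hw).imp id fun h' => ⟨h, h'⟩
  induction F using Multiset.induction_on with
  | empty => exact ⟨_, isFlattening_one, fun w hw => .inl (Multiset.mem_singleton.1 hw)⟩
  | cons T F ih =>
    obtain ⟨d, hd, hd'⟩ := ih ⟨fun S hS => hF.1 S (Multiset.mem_cons_of_mem hS),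
      fun S hS => hF.2 S (Multiset.mem_cons_of_mem hS)⟩
    obtain ⟨c, hc, hc'⟩ := T.exists_isFlattening (hF.1 T (Multiset.mem_cons_self T F))
    rw [hF.2 T (Multiset.mem_cons_self T F)] at hc'
    refine ⟨c.bind fun u => d.bind fun v => shuffle u v, ?_, ?_⟩
    · simp only [chenT_cons]
      exact hc.mul hd
    · intro w hw
      simp only [Multiset.mem_bind] at hw
      obtain ⟨u, hu, v, hv, hw⟩ := hw
      exact head?_of_mem_shuffle (.inr (hc' u hu)) (hd' v hv) hw

/-! ### Arborified zeta values -/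

theorem IsFlattening.tendsto_chenT {F : Forest Letter} {c : Multiset (List Letter)}
    (hc : IsFlattening (fun ε => chenT ε F) c) (hconv : ∀ w ∈ c, IsConvergentWord w) {z : ℝ}
    (hz : z ∈ Ioo (0 : ℝ) 1) :
    Tendsto (fun ε => chenT ε F z) (𝓝[>] 0) (𝓝 (c.map fun w => Li w z).sum) := by
  refine (tendsto_multiset_sum c fun w hw => tendsto_chen (hconv w hw) hz).congr' ?_
  filter_upwards [Ioo_mem_nhdsGT one_pos] with ε hε
  exact (hc.eq_sum ε hε z hz).symm

theorem IsFlattening.tendsto_LiT {F : Forest Letter} {c : Multiset (List Letter)}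
    (hc : IsFlattening (fun ε => chenT ε F) c) (hconv : ∀ w ∈ c, IsConvergentWord w) :
    Tendsto (LiT F) (𝓝[<] 1) (𝓝 (c.map zeta).sum) := by
  refine (tendsto_multiset_sum c fun w hw => tendsto_Li (hconv w hw)).congr' ?_
  filter_upwards [Ioo_mem_nhdsLT one_pos] with z hz
  rw [LiT_eq_limUnder F hz, (hc.tendsto_chenT hconv hz).limUnder_eq]

theorem tendsto_chenT {F : Forest Letter} (hF : F.IsConvergent) {z : ℝ}
    (hz : z ∈ Ioo (0 : ℝ) 1) : Tendsto (fun ε => chenT ε F z) (𝓝[>] 0) (𝓝 (LiT F z)) := by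
  obtain ⟨c, hc, hconv⟩ := Forest.exists_isFlattening hF
  rw [LiT_eq_limUnder F hz]
  exact tendsto_nhds_limUnder ⟨_, hc.tendsto_chenT hconv hz⟩

theorem tendsto_LiT {F : Forest Letter} (hF : F.IsConvergent) :
    Tendsto (LiT F) (𝓝[<] 1) (𝓝 (zetaT F)) := by
  obtain ⟨c, hc, hconv⟩ := Forest.exists_isFlattening hF
  exact tendsto_nhds_limUnder ⟨_, hc.tendsto_LiT hconv⟩

/-- Multiplicities in the multiset become the integer coefficients. -/
theorem exists_finsupp_sum_eq {α : Type*} {p : α → Prop} (f : α → ℝ) (s : Multiset α)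
    (hs : ∀ a ∈ s, p a) :
    ∃ c : α →₀ ℤ, (∀ a ∈ c.support, p a) ∧ (s.map f).sum = c.sum fun a n => (n : ℝ) * f a := by
  classical
  induction s using Multiset.induction_on with
  | empty => exact ⟨0, by simp⟩
  | cons a s ih =>
    obtain ⟨c, hc, h⟩ := ih fun b hb => hs b (Multiset.mem_cons_of_mem hb)
    refine ⟨Finsupp.single a 1 + c, fun b hb => ?_, ?_⟩
    · rcases Finset.mem_union.1 (Finsupp.support_add hb) with hb | hb
      · rw [Finset.mem_singleton.1 (Finsupp.support_single_subset hb)]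
        exact hs a (Multiset.mem_cons_self a s)
      · exact hc b hb
    · rw [Multiset.map_cons, Multiset.sum_cons, h,
        Finsupp.sum_add_index' (by simp) (by intros; push_cast; ring),
        Finsupp.sum_single_index (by simp)]
      simp

theorem exists_zetaT_eq_sum {F : Forest Letter} (hF : F.IsConvergent) :
    ∃ c : List Letter →₀ ℤ, (∀ w ∈ c.support, IsConvergentWord w) ∧
      zetaT F = c.sum fun w n => (n : ℝ) * zeta w := by
  obtain ⟨c, hc, hconv⟩ := Forest.exists_isFlattening hF
  rw [tendsto_nhds_unique (tendsto_LiT hF) (hc.tendsto_LiT hconv)]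
  exact exists_finsupp_sum_eq zeta c hconv

theorem LiT_zero {z : ℝ} (hz : z ∈ Ioo (0 : ℝ) 1) : LiT 0 z = 1 :=
  tendsto_nhds_unique (tendsto_chenT Forest.isConvergent_zero hz)
    (by simp only [chenT_zero, Pi.one_apply]; exact tendsto_const_nhds)

theorem LiT_add {F F' : Forest Letter} (hF : F.IsConvergent) (hF' : F'.IsConvergent) {z : ℝ}
    (hz : z ∈ Ioo (0 : ℝ) 1) : LiT (F + F') z = LiT F z * LiT F' z :=
  tendsto_nhds_unique (tendsto_chenT (hF.add hF') hz) (by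
    simp only [chenT_add, Pi.mul_apply]
    exact (tendsto_chenT hF hz).mul (tendsto_chenT hF' hz))

theorem zetaT_zero : zetaT 0 = 1 := by
  refine tendsto_nhds_unique (tendsto_LiT Forest.isConvergent_zero)
    (tendsto_const_nhds.congr' ?_)
  filter_upwards [Ioo_mem_nhdsLT one_pos] with z hz
  exact (LiT_zero hz).symm

theorem zetaT_add {F F' : Forest Letter} (hF : F.IsConvergent) (hF' : F'.IsConvergent) :
    zetaT (F + F') = zetaT F * zetaT F' := by
  refine tendsto_nhds_unique (tendsto_LiT (hF.add hF'))
    (((tendsto_LiT hF).mul (tendsto_LiT hF')).congr' ?_)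
  filter_upwards [Ioo_mem_nhdsLT one_pos] with z hz
  exact (LiT_add hF hF' hz).symm

/-- The linear extension of `zetaT` to the algebra of all forests. -/
noncomputable def zetaTLin : ForestAlg Letter →ₗ[ℝ] ℝ :=
  Finsupp.linearCombination ℝ zetaT ∘ₗ (AddMonoidAlgebra.coeffLinearEquiv ℝ).toLinearMap

theorem zetaTLin_single (F : Forest Letter) (r : ℝ) :
    zetaTLin (AddMonoidAlgebra.single F r) = r * zetaT F := by
  simp [zetaTLin]

/-- By bilinearity it is enough to treat generators, where convergence makes `zetaT_add` available.
-/
theorem zetaTLin_mul {a b : ForestAlg Letter} (ha : a ∈ convAlg) (hb : b ∈ convAlg) :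
    zetaTLin (a * b) = zetaTLin a * zetaTLin b := by
  refine Submodule.span_induction₂ (p := fun a b _ _ => zetaTLin (a * b) = zetaTLin a * zetaTLin b)
    ?_ ?_ ?_ ?_ ?_ ?_ ?_ ha hb
  · rintro _ _ ⟨F, hF, rfl⟩ ⟨F', hF', rfl⟩
    simp [AddMonoidAlgebra.single_mul_single, zetaTLin_single, zetaT_add hF hF']
  · intros; simp
  · intros; simp
  · intro a b c _ _ _ h1 h2; simp only [add_mul, map_add, h1, h2]
  · intro a b c _ _ _ h1 h2; simp only [mul_add, map_add, h1, h2]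
  · intro r a b _ _ h; simp [h, mul_assoc]
  · intro r a b _ _ h; simp [h, mul_left_comm]

/-- The shuffle arborified zeta map as a morphism of unital algebras. -/
noncomputable def zetaTAlgHom : convAlg →ₐ[ℝ] ℝ :=
  AlgHom.ofLinearMap zetaTConv
    (by
      -- The unit of the algebra is the empty forest with coefficient 1.
      change zetaTLin (AddMonoidAlgebra.single 0 1) = 1
      rw [zetaTLin_single, zetaT_zero, one_mul])
    fun a b => zetaTLin_mul a.2 b.2

end ArborifiedZeta

theorem theorem3 :
    -- shuffle multiple zeta values of convergent words exist as genuine limits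
    (∀ w : List Letter, IsConvergentWord w →
      (∀ z ∈ Set.Ioo (0 : ℝ) 1, Tendsto (fun ε => chen ε w z) (𝓝[>] 0)
        (𝓝 (Li w z))) ∧
      Tendsto (Li w) (𝓝[<] 1) (𝓝 (zeta w))) ∧
    -- shuffle arborified zeta values exist and are integral combinations of multiple zeta values
    (∀ F : Forest Letter, F.IsConvergent →
      (∀ z ∈ Set.Ioo (0 : ℝ) 1, Tendsto (fun ε => chenT ε F z) (𝓝[>] 0)
        (𝓝 (LiT F z))) ∧
      Tendsto (LiT F) (𝓝[<] 1) (𝓝 (zetaT F)) ∧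
      ∃ c : List Letter →₀ ℤ,
        (∀ w ∈ c.support, IsConvergentWord w) ∧
        zetaT F = c.sum fun w n => (n : ℝ) * zeta w) ∧
    -- the shuffle arborified zeta map is a morphism of unital algebras
    ∃ Z : convAlg →ₐ[ℝ] ℝ, ∀ F : convAlg,
      Z F = zetaTConv F := by
  exact ⟨fun w hw => ⟨fun z hz => tendsto_chen hw hz, tendsto_Li hw⟩,
    fun F hF => ⟨fun z hz => tendsto_chenT hF hz, tendsto_LiT hF, exists_zetaT_eq_sum hF⟩,
    zetaTAlgHom, fun _ => rfl⟩
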